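/- Let $(\mathbb{M},d)$ be a non-empty compact metric space, let $\mathbb{K}=\mathbb{N}=\{0,1,2,\dots\}$ or $\mathbb{K}=\mathbb{Z}$, let $\sigma:\mathbb{M}^{\mathbb{K}}\to\mathbb{M}^{\mathbb{K}}$, $\sigma((x_k)_k)=(x_{k+1})_k$, be the left shift, and put $$\mathbf{d}(\bar x,\bar y)=\sum_{j\in\mathbb{K}}2^{-|j|}\,d(x_j,y_j),\qquad \bar x=(x_j),\ \bar y=(y_j)\in\mathbb{M}^{\mathbb{K}} .$$ For a compact metric space $(X,\rho)$, $s\ge 0$ and $\varepsilon>0$, let $$\mathrm{H}^s_\varepsilon(X,\rho)=\inf\Big\{\sum_{n=1}^\infty(\operatorname{diam}E_n)^s:\ X=\bigcup_{n=1}^\infty E_n,\ \operatorname{diam}E_n<\varepsilon\text{ for all }n\Big\},$$ with the conventions $0^0=1$ and $(\operatorname{diam}\emptyset)^s=0$, and let $\dim_{\mathrm H}(X,\rho,\varepsilon)=\sup\{s\ge 0:\mathrm{H}^s_\varepsilon(X,\rho)\ge 1\}$. For a continuous map $f:X\to X$ and $n\ge 1$ let $\rho_n(x,y)=\max_{0\le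 i<n}\rho(f^i(x),f^i(y))$. The lower and upper mean Hausdorff dimensions of $(X,\rho,f)$ are $$\underline{\mathrm{mdim}}_{\mathrm H}(X,\rho,f)=\lim_{\varepsilon\to0}\liminf_{n\to\infty}\frac1n\dim_{\mathrm H}(X,\rho_n,\varepsilon),\qquad \overline{\mathrm{mdim}}_{\mathrm H}(X,\rho,f)=\lim_{\varepsilon\to0}\limsup_{n\to\infty}\frac1n\dim_{\mathrm H}(X,\rho_n,\varepsilon).$$ Let $\dim_{\mathrm H}(\mathbb{M},d)$ be the Hausdorff dimension of $(\mathbb{M},d)$, and let $\underline{\dim}_{\mathrm B}(\mathbb{M},d)=\liminf_{\delta\to0}\frac{\log N(\delta)}{-\log\delta}$ be its lower box dimension, where $N(\delta)$ is the smallest number of sets of diameter at most $\delta$ that cover $\mathbb{M}$. All these dimensions take values in $[0,\infty]$. Then $$\dim_{\mathrm H}(\mathbb{M},d)\le\underline{\mathrm{mdim}}_{\mathrm H}(\mathbb{M}^{\mathbb{K}},\mathbf{d},\sigma)\le\overline{\mathrm{mdim}}_{\mathrm H}(\mathbb{M}^{\mathbb{K}},\mathbf{d},\sigma)\le\underline{\dim}_{\mathrm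 B}(\mathbb{M},d).$$ -/

import Mathlib

open Filter Topology MeasureTheory
open scoped ENNReal NNReal

/-! Distances are passed as explicit functions `ρ : X → X → ℝ`, because the sequence space `K → M`
carries, for each `n`, a different distance. -/

namespace MeanHausdorff

/-- The diameter of `E` with respect to `ρ`. -/
noncomputable def setDiam {X : Type*} (ρ : X → X → ℝ) (E : Set X) : ℝ≥0∞ :=
  ⨆ x ∈ E, ⨆ y ∈ E, ENNReal.ofReal (ρ x y)

open Classical in
/-- `(diam E) ^ s`, with the conventions `0 ^ 0 = 1` and `(diam ∅) ^ s = 0`. -/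
noncomputable def diamPow {X : Type*} (ρ : X → X → ℝ) (s : ℝ≥0) (E : Set X) : ℝ≥0∞ :=
  if E = ∅ then 0 else setDiam ρ E ^ (s : ℝ)

/-- `H^s_ε (X, ρ)`: the infimum of `∑ (diam Eₙ) ^ s` over the countable covers `X = ⋃ Eₙ`
with `diam Eₙ < ε` for all `n`. -/
noncomputable def hausdorffContent {X : Type*} (ρ : X → X → ℝ) (s : ℝ≥0) (ε : ℝ) : ℝ≥0∞ :=
  ⨅ (E : ℕ → Set X) (_ : ⋃ n, E n = Set.univ) (_ : ∀ n, setDiam ρ (E n) < ENNReal.ofReal ε),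
    ∑' n, diamPow ρ s (E n)

/-- `dim_H (X, ρ, ε) = sup {s ≥ 0 : H^s_ε (X, ρ) ≥ 1}`. -/
noncomputable def dimHScale {X : Type*} (ρ : X → X → ℝ) (ε : ℝ) : ℝ≥0∞ :=
  ⨆ (s : ℝ≥0) (_ : 1 ≤ hausdorffContent ρ s ε), (s : ℝ≥0∞)

/-- The dynamical distance `dₙ(x, y) = max_{0 ≤ i < n} ρ (fⁱ x, fⁱ y)` (and `0` for `n = 0`). -/
noncomputable def dynDist {X : Type*} (ρ : X → X → ℝ) (f : X → X) (n : ℕ) (x y : X) : ℝ :=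
  ⨆ i : Fin n, ρ (f^[i] x) (f^[i] y)

/-- Lower mean Hausdorff dimension: `lim_{ε → 0} liminf_n (1/n) dim_H (X, dₙ, ε)`. The limit is
monotone, hence a supremum; see `tendsto_lowerMeanDimH`. -/
noncomputable def lowerMeanDimH {X : Type*} (ρ : X → X → ℝ) (f : X → X) : ℝ≥0∞ :=
  ⨆ (ε : ℝ) (_ : 0 < ε), liminf (fun n : ℕ => dimHScale (dynDist ρ f n) ε / n) atTop

/-- Upper mean Hausdorff dimension: `lim_{ε → 0} limsup_n (1/n) dim_H (X, dₙ, ε)`. The limit is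
monotone, hence a supremum; see `tendsto_upperMeanDimH`. -/
noncomputable def upperMeanDimH {X : Type*} (ρ : X → X → ℝ) (f : X → X) : ℝ≥0∞ :=
  ⨆ (ε : ℝ) (_ : 0 < ε), limsup (fun n : ℕ => dimHScale (dynDist ρ f n) ε / n) atTop

/-- The least number of sets of diameter at most `δ` that cover `M`. -/
noncomputable def boxNumber (M : Type*) [MetricSpace M] (δ : ℝ) : ℕ :=
  sInf {m : ℕ | ∃ E : Fin m → Set M,
    ⋃ i, E i = Set.univ ∧ ∀ i, Metric.ediam (E i) ≤ ENNReal.ofReal δ}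

/-- Lower box dimension `liminf_{δ → 0} log N(δ) / (-log δ)`, as an element of `[0, ∞]`. -/
noncomputable def lowerBoxDim (M : Type*) [MetricSpace M] : ℝ≥0∞ :=
  liminf (fun δ : ℝ => ENNReal.ofReal (Real.log (boxNumber M δ) / (-Real.log δ))) (𝓝[>] 0)

/-- The left shift on `M^K`, for `K = ℕ` or `K = ℤ`. -/
def shift {K M : Type*} [Add K] [One K] (x : K → M) : K → M := fun k => x (k + 1)

/-- The distance `∑_{j ∈ ℕ} 2^{-j} d(xⱼ, yⱼ)` on `M^ℕ`. -/
noncomputable def seqDist {M : Type*} [MetricSpace M] (x y : ℕ → M) : ℝ :=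
  ∑' j : ℕ, (1 / 2 ^ j) * dist (x j) (y j)

/-- The distance `∑_{j ∈ ℤ} 2^{-|j|} d(xⱼ, yⱼ)` on `M^ℤ`. -/
noncomputable def biseqDist {M : Type*} [MetricSpace M] (x y : ℤ → M) : ℝ :=
  ∑' j : ℤ, (1 / 2 ^ j.natAbs) * dist (x j) (y j)

/-! The series above converge, and the suprema over `ε` are limits as `ε → 0`. -/

theorem summable_seqDist {M : Type*} [MetricSpace M] [CompactSpace M] (x y : ℕ → M) :
    Summable fun j : ℕ => ((1 : ℝ) / 2 ^ j) * dist (x j) (y j) := by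
  refine Summable.of_nonneg_of_le (fun j => by positivity) (fun j => ?_)
    (summable_geometric_two.mul_right (Metric.diam (Set.univ : Set M)))
  rw [one_div_pow]
  gcongr
  exact Metric.dist_le_diam_of_mem isCompact_univ.isBounded trivial trivial

theorem summable_biseqDist {M : Type*} [MetricSpace M] [CompactSpace M] (x y : ℤ → M) :
    Summable fun j : ℤ => ((1 : ℝ) / 2 ^ j.natAbs) * dist (x j) (y j) := by
  refine Summable.of_nat_of_neg ?_ ?_
  · simpa using summable_seqDist (fun j : ℕ => x j) (fun j : ℕ => y j)
  · simpa using summable_seqDist (fun j : ℕ => x (-j)) (fun j : ℕ => y (-j))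

theorem hausdorffContent_anti {X : Type*} (ρ : X → X → ℝ) (s : ℝ≥0) :
    Antitone (hausdorffContent ρ s) := fun _ _ h =>
  le_iInf fun E => le_iInf fun h1 => le_iInf fun h2 =>
    iInf_le_of_le E <| iInf_le_of_le h1 <|
      iInf_le_of_le (fun n => (h2 n).trans_le (ENNReal.ofReal_le_ofReal h)) le_rfl

theorem dimHScale_anti {X : Type*} (ρ : X → X → ℝ) : Antitone (dimHScale ρ) := fun _ _ h =>
  iSup_le fun s => iSup_le fun hs =>
    le_iSup₂_of_le s (hs.trans (hausdorffContent_anti ρ s h)) le_rfl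

theorem tendsto_iSup_of_antitone {g : ℝ → ℝ≥0∞} (hg : Antitone g) :
    Tendsto g (𝓝[>] 0) (𝓝 (⨆ (ε : ℝ) (_ : 0 < ε), g ε)) := by
  have h := (hg.antitoneOn (Set.Ioi 0)).tendsto_nhdsGT (x := (0 : ℝ)) (OrderTop.bddAbove _)
  rwa [sSup_image] at h

theorem tendsto_lowerMeanDimH {X : Type*} (ρ : X → X → ℝ) (f : X → X) :
    Tendsto (fun ε : ℝ => liminf (fun n : ℕ => dimHScale (dynDist ρ f n) ε / n) atTop)
      (𝓝[>] 0) (𝓝 (lowerMeanDimH ρ f)) :=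
  tendsto_iSup_of_antitone fun _ _ h => liminf_le_liminf <| Eventually.of_forall fun _ =>
    ENNReal.div_le_div_right (dimHScale_anti _ h) _

theorem tendsto_upperMeanDimH {X : Type*} (ρ : X → X → ℝ) (f : X → X) :
    Tendsto (fun ε : ℝ => limsup (fun n : ℕ => dimHScale (dynDist ρ f n) ε / n) atTop)
      (𝓝[>] 0) (𝓝 (upperMeanDimH ρ f)) :=
  tendsto_iSup_of_antitone fun _ _ h => limsup_le_limsup <| Eventually.of_forall fun _ =>
    ENNReal.div_le_div_right (dimHScale_anti _ h) _

/-! The Hausdorff dimension computed from `dimHScale` is Mathlib's `dimH`. -/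

theorem setDiam_dist {M : Type*} [MetricSpace M] (E : Set M) :
    setDiam dist E = Metric.ediam E := by
  simp [setDiam, Metric.ediam, edist_dist]

theorem diamPow_dist {M : Type*} [MetricSpace M] (s : ℝ≥0) (E : Set M) :
    diamPow dist s E = ⨆ _ : E.Nonempty, Metric.ediam E ^ (s : ℝ) := by
  rcases E.eq_empty_or_nonempty with rfl | h
  · simp [diamPow]
  · simp [diamPow, h, h.ne_empty, setDiam_dist]

theorem iSup_dimHScale_eq_dimH (M : Type*) [MetricSpace M] :
    ⨆ (ε : ℝ) (_ : 0 < ε), dimHScale (dist : M → M → ℝ) ε = dimH (Set.univ : Set M) := by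
  borelize M
  apply le_antisymm
  · refine iSup₂_le fun ε hε => iSup₂_le fun s hs => ?_
    by_contra! hlt
    have h0 := hausdorffMeasure_of_dimH_lt hlt
    obtain ⟨r, hr0, hr⟩ := exists_between (ENNReal.ofReal_pos.2 hε)
    rw [Measure.hausdorffMeasure_apply] at h0
    have h1 := ENNReal.iSup_eq_zero.1 (ENNReal.iSup_eq_zero.1 h0 r) hr0
    have : hausdorffContent (dist : M → M → ℝ) s ε ≤ 0 := by
      rw [← h1]
      refine le_iInf fun E => le_iInf fun hE => le_iInf fun hd => ?_
      refine iInf_le_of_le E <| iInf_le_of_le (Set.univ_subset_iff.1 hE) <|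
        iInf_le_of_le (fun n => ?_) ?_
      · rw [setDiam_dist]
        exact (hd n).trans_lt hr
      · simp [diamPow_dist]
    exact absurd (hs.trans this) (by simp)
  · refine dimH_le fun s hs => ?_
    rw [Measure.hausdorffMeasure_apply] at hs
    have h1 : (1 : ℝ≥0∞) < ⊤ := ENNReal.one_lt_top
    rw [← hs] at h1
    obtain ⟨r, h1⟩ := lt_iSup_iff.1 h1
    obtain ⟨hr, h1⟩ := lt_iSup_iff.1 h1
    obtain ⟨ε, hε0, hε⟩ : ∃ ε : ℝ, 0 < ε ∧ ENNReal.ofReal ε ≤ r := by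
      rcases eq_or_ne r ⊤ with rfl | h
      · exact ⟨1, one_pos, le_top⟩
      · exact ⟨r.toReal, ENNReal.toReal_pos hr.ne' h, by rw [ENNReal.ofReal_toReal h]⟩
    refine le_iSup₂_of_le ε hε0 (le_iSup₂_of_le s (h1.le.trans ?_) le_rfl)
    refine le_iInf fun E => le_iInf fun hE => le_iInf fun hd => ?_
    refine iInf_le_of_le E <| iInf_le_of_le hE.ge <| iInf_le_of_le (fun n => ?_) ?_
    · rw [← setDiam_dist]
      exact (hd n).le.trans hε
    · simp [diamPow_dist]

end MeanHausdorff

/-! Upper bound: up to an error `C * δ`, the first `n` iterates see only `n + L` coordinates, with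
`L` depending on `δ` alone. An optimal `δ`-cover of `M` thus gives `N(δ)^(n+L)` sets of dynamical
diameter at most `C * δ`, and the rate at scale `ε` is at most `log N(δ) / -log (C * δ)` for every
small `δ`. The constant `C` disappears as `δ → 0`, leaving the liminf
(`upperMeanDimH_le_lowerBoxDim`).

Lower bound: the dynamical distance dominates the sup distance of coordinates `0, ..., n-1`, so for
`s < dimH M` it is enough to bound covers of `M^n` by cubes at exponent `n * s`, at a scale
independent of `n`. The induction on `n` needs weighted covers. By Vitali, a weighted cover of `M`
by small balls satisfies `∑ c r^s ≥ 1` (`one_le_sum_of_weighted_ball_cover`). Freezing one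
coordinate turns a weighted cover of the product into one of fewer factors (`one_le_sum_mul_pow`).
The bound `1` passes through with no loss, so one scale serves all `n`; no Frostman measure is
needed. -/

namespace MeanHausdorff

/-! ### Content and countable covers -/

section Content

variable {X : Type*} {ρ : X → X → ℝ}

theorem setDiam_empty : setDiam ρ (∅ : Set X) = 0 := by simp [setDiam]

theorem diamPow_empty (s : ℝ≥0) : diamPow ρ s (∅ : Set X) = 0 := by simp [diamPow]

theorem diamPow_le (s : ℝ≥0) (E : Set X) : diamPow ρ s E ≤ setDiam ρ E ^ (s : ℝ) := by
  unfold diamPow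
  split_ifs <;> simp

theorem diamPow_of_pos {s : ℝ≥0} (hs : 0 < s) (E : Set X) :
    diamPow ρ s E = setDiam ρ E ^ (s : ℝ) := by
  unfold diamPow
  split_ifs with h
  · rw [h, setDiam_empty, ENNReal.zero_rpow_of_pos (by exact_mod_cast hs)]
  · rfl

theorem setDiam_le {E : Set X} {r : ℝ} (h : ∀ x ∈ E, ∀ y ∈ E, ρ x y ≤ r) :
    setDiam ρ E ≤ ENNReal.ofReal r :=
  iSup₂_le fun x hx => iSup₂_le fun y hy => ENNReal.ofReal_le_ofReal (h x hx y hy)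

theorem le_setDiam {E : Set X} {x y : X} (hx : x ∈ E) (hy : y ∈ E) :
    ENNReal.ofReal (ρ x y) ≤ setDiam ρ E :=
  le_iSup₂_of_le x hx (le_iSup₂_of_le y hy le_rfl)

/-- Covers indexed by an arbitrary countable type may be used to bound the content. -/
theorem hausdorffContent_le_tsum {ι : Type*} [Countable ι] (s : ℝ≥0) {ε : ℝ} (hε : 0 < ε)
    (E : ι → Set X) (hE : ⋃ i, E i = Set.univ) (hd : ∀ i, setDiam ρ (E i) < ENNReal.ofReal ε) :
    hausdorffContent ρ s ε ≤ ∑' i, diamPow ρ s (E i) := by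
  obtain ⟨_⟩ := nonempty_encodable ι
  refine iInf_le_of_le (fun n => ⋃ b ∈ Encodable.decode₂ ι n, E b) <|
    iInf_le_of_le ((Encodable.iUnion_decode₂ E).trans hE) <| iInf_le_of_le (fun n => ?_) ?_
  · refine Encodable.iUnion_decode₂_cases
      (C := fun A => setDiam ρ A < ENNReal.ofReal ε) ?_ hd
    simpa [setDiam_empty] using hε
  · rw [tsum_iUnion_decode₂ (diamPow ρ s) (diamPow_empty s) E]

end Content

/-! ### Lower bound through weighted ball covers -/

section Lower

variable {M : Type*} [MetricSpace M]

/-- Below the dimension the Hausdorff measure is infinite, so fine-scale content exceeds any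
constant, in particular the Vitali loss `10 ^ s`. -/
theorem exists_le_hausdorffContent {s : ℝ≥0} (hs : (s : ℝ≥0∞) < dimH (Set.univ : Set M))
    {C : ℝ≥0∞} (hC : C < ⊤) :
    ∃ ε : ℝ, 0 < ε ∧ C ≤ hausdorffContent (dist : M → M → ℝ) s ε := by
  borelize M
  have hs := hausdorffMeasure_of_lt_dimH hs
  rw [Measure.hausdorffMeasure_apply] at hs
  rw [← hs] at hC
  obtain ⟨r, hC⟩ := lt_iSup_iff.1 hC
  obtain ⟨hr, hC⟩ := lt_iSup_iff.1 hC
  obtain ⟨ε, hε0, hε⟩ : ∃ ε : ℝ, 0 < ε ∧ ENNReal.ofReal ε ≤ r := by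
    rcases eq_or_ne r ⊤ with rfl | h
    · exact ⟨1, one_pos, le_top⟩
    · exact ⟨r.toReal, ENNReal.toReal_pos hr.ne' h, by rw [ENNReal.ofReal_toReal h]⟩
  refine ⟨ε, hε0, hC.le.trans <| le_iInf fun E => le_iInf fun hE => le_iInf fun hd => ?_⟩
  refine iInf_le_of_le E <| iInf_le_of_le hE.ge <| iInf_le_of_le (fun n => ?_) ?_
  · rw [← setDiam_dist]
    exact (hd n).le.trans hε
  · simp [diamPow_dist]

/-- A finite cover by small balls has a disjoint subfamily whose enlargement still covers. -/
theorem exists_disjoint_one_le_sum {ι : Type*} {s : ℝ≥0} {ε : ℝ} (hε : 0 < ε)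
    (hc : ENNReal.ofReal (10 ^ (s : ℝ)) ≤ hausdorffContent (dist : M → M → ℝ) s ε)
    (F : Finset ι) (x : ι → M) (r : ι → ℝ) (hr0 : ∀ k, 0 < r k) (hr : ∀ k, 10 * r k < ε)
    (hF : ∀ y, ∃ k ∈ F, y ∈ Metric.closedBall (x k) (r k)) :
    ∃ G ⊆ F, (G : Set ι).PairwiseDisjoint (fun k => Metric.closedBall (x k) (r k)) ∧
      1 ≤ ∑ k ∈ G, r k ^ (s : ℝ) := by
  obtain ⟨u, huF, hdis, hu⟩ := Vitali.exists_disjoint_subfamily_covering_enlargement_closedBall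
    (F : Set ι) x r (ε / 10) (fun k _ => by linarith [hr k]) 5 (by norm_num)
  lift u to Finset ι using F.finite_toSet.subset huF
  refine ⟨u, by exact_mod_cast huF, hdis, ?_⟩
  -- Enlargement by 5 gives diameter at most `10 * r k`: hence the constants `10 ^ s` and `ε / 10`.
  have hdiam : ∀ k, setDiam dist (Metric.closedBall (x k) (5 * r k))
      ≤ ENNReal.ofReal (10 * r k) := fun k => setDiam_le fun a ha b hb => by
    linarith [dist_triangle_right a b (x k), Metric.mem_closedBall.1 ha, Metric.mem_closedBall.1 hb]
  have key := hausdorffContent_le_tsum (ρ := (dist : M → M → ℝ)) s hε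
    (fun k : u => Metric.closedBall (x k) (5 * r k)) (by
      refine Set.eq_univ_of_forall fun y => ?_
      obtain ⟨k, hk, hy⟩ := hF y
      obtain ⟨b, hb, hsub⟩ := hu k hk
      exact Set.mem_iUnion.2 ⟨⟨b, hb⟩, hsub hy⟩)
    (fun k => (hdiam k).trans_lt ((ENNReal.ofReal_lt_ofReal_iff hε).2 (hr k)))
  rw [tsum_fintype, Finset.sum_coe_sort u
    (fun k => diamPow dist s (Metric.closedBall (x k) (5 * r k)))] at key
  have h2 : ∑ k ∈ u, diamPow dist s (Metric.closedBall (x k) (5 * r k)) ≤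
      ENNReal.ofReal (10 ^ (s : ℝ) * ∑ k ∈ u, r k ^ (s : ℝ)) := by
    rw [Finset.mul_sum, ENNReal.ofReal_sum_of_nonneg
      (fun k _ => by have := hr0 k; positivity)]
    refine Finset.sum_le_sum fun k _ => (diamPow_le _ _).trans ?_
    rw [← Real.mul_rpow (by norm_num) (hr0 k).le,
      ← ENNReal.ofReal_rpow_of_nonneg (by have := hr0 k; positivity) (NNReal.coe_nonneg s)]
    exact ENNReal.rpow_le_rpow (hdiam k) (NNReal.coe_nonneg s)
  have h3 := hc.trans (key.trans h2)
  rw [ENNReal.ofReal_le_ofReal_iff (by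
    have := fun k => (hr0 k).le
    exact mul_nonneg (by positivity) (Finset.sum_nonneg fun k _ => Real.rpow_nonneg (this k) _))]
    at h3
  have h10 : (0 : ℝ) < 10 ^ (s : ℝ) := by positivity
  nlinarith

open Classical in
-- An `m`-fold cover is peeled into `m` disjoint families, each contributing at least 1.
theorem natCast_le_sum_of_ball_cover {ι : Type*} {s : ℝ≥0} {ε : ℝ} (hε : 0 < ε)
    (hc : ENNReal.ofReal (10 ^ (s : ℝ)) ≤ hausdorffContent (dist : M → M → ℝ) s ε)
    (F : Finset ι) (x : ι → M) (r : ι → ℝ) (hr0 : ∀ k, 0 < r k) (hr : ∀ k, 10 * r k < ε)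
    (m : ℕ) (μ : ι → ℕ)
    (hμ : ∀ y, m ≤ ∑ k ∈ F, if y ∈ Metric.closedBall (x k) (r k) then μ k else 0) :
    (m : ℝ) ≤ ∑ k ∈ F, (μ k : ℝ) * r k ^ (s : ℝ) := by
  induction m generalizing μ with
  | zero =>
    exact_mod_cast Finset.sum_nonneg fun k _ =>
      mul_nonneg (Nat.cast_nonneg _) (Real.rpow_nonneg (hr0 k).le _)
  | succ m ih =>
    obtain ⟨G, hG, hdis, h1⟩ := exists_disjoint_one_le_sum hε hc (F.filter fun k => μ k ≠ 0)
      x r hr0 hr fun y => by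
        obtain ⟨k, hk, hne⟩ := Finset.exists_ne_zero_of_sum_ne_zero
          (Nat.ne_of_gt ((Nat.succ_pos m).trans_le (hμ y)))
        rw [Ne, ite_eq_right_iff, Classical.not_imp] at hne
        exact ⟨k, Finset.mem_filter.2 ⟨hk, hne.2⟩, hne.1⟩
    have hGF : G ⊆ F := hG.trans (Finset.filter_subset _ _)
    obtain ⟨ν, hsplit⟩ : ∃ ν : ι → ℕ, ∀ k, μ k = ν k + if k ∈ G then 1 else 0 := by
      refine ⟨fun k => μ k - if k ∈ G then 1 else 0, fun k => ?_⟩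
      by_cases hk : k ∈ G
      · have := (Finset.mem_filter.1 (hG hk)).2
        simp only [hk, if_true]
        omega
      · simp [hk]
    have hsum := ih ν fun y => by
      -- Disjointness: lowering the multiplicities on `G` by one costs each point at most one layer.
      have hle : ∑ k ∈ G, (if y ∈ Metric.closedBall (x k) (r k) then 1 else 0) ≤ 1 := by
        rw [← Finset.card_filter, Finset.card_le_one]
        intro a ha b hb
        rw [Finset.mem_filter] at ha hb
        by_contra hab
        exact Set.disjoint_left.1 (hdis ha.1 hb.1 hab) ha.2 hb.2
      have heq : (∑ k ∈ F, if y ∈ Metric.closedBall (x k) (r k) then μ k else 0) =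
          (∑ k ∈ F, if y ∈ Metric.closedBall (x k) (r k) then ν k else 0) +
          ∑ k ∈ G, (if y ∈ Metric.closedBall (x k) (r k) then 1 else 0) := by
        rw [← Finset.inter_eq_right.2 hGF, ← Finset.sum_ite_mem, ← Finset.sum_add_distrib]
        refine Finset.sum_congr rfl fun k _ => ?_
        have := hsplit k
        by_cases hk : k ∈ G <;> by_cases hy : y ∈ Metric.closedBall (x k) (r k) <;>
          simp only [hk, hy, if_true, if_false] at this ⊢ <;> omega
      have := hμ y
      omega
    have heq : ∑ k ∈ F, (μ k : ℝ) * r k ^ (s : ℝ) =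
        ∑ k ∈ F, (ν k : ℝ) * r k ^ (s : ℝ) + ∑ k ∈ G, r k ^ (s : ℝ) := by
      rw [← Finset.inter_eq_right.2 hGF, ← Finset.sum_ite_mem, ← Finset.sum_add_distrib]
      refine Finset.sum_congr rfl fun k _ => ?_
      have : (μ k : ℝ) = ν k + if k ∈ G then 1 else 0 := by exact_mod_cast hsplit k
      rw [this]
      split_ifs <;> ring
    push_cast
    linarith

open Classical in
-- Scale the weights by `N` and round up: the rounding error `∑ r ^ s` does not depend on `N`, so it
-- vanishes after dividing by `N`.
theorem one_le_sum_of_weighted_ball_cover {ι : Type*} {s : ℝ≥0} {ε : ℝ} (hε : 0 < ε)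
    (hc : ENNReal.ofReal (10 ^ (s : ℝ)) ≤ hausdorffContent (dist : M → M → ℝ) s ε)
    (F : Finset ι) (x : ι → M) (r : ι → ℝ) (hr0 : ∀ k, 0 < r k) (hr : ∀ k, 10 * r k < ε)
    (c : ι → ℝ) (hc0 : ∀ k, 0 ≤ c k)
    (h : ∀ y, 1 ≤ ∑ k ∈ F, c k * if y ∈ Metric.closedBall (x k) (r k) then 1 else 0) :
    1 ≤ ∑ k ∈ F, c k * r k ^ (s : ℝ) := by
  have hb : ∀ N : ℕ, (N : ℝ) * (1 - ∑ k ∈ F, c k * r k ^ (s : ℝ)) ≤ ∑ k ∈ F, r k ^ (s : ℝ) := by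
    intro N
    have h1 := natCast_le_sum_of_ball_cover hε hc F x r hr0 hr N (fun k => ⌈N * c k⌉₊) fun y => by
      have : (N : ℝ) ≤ ((∑ k ∈ F, if y ∈ Metric.closedBall (x k) (r k) then ⌈N * c k⌉₊ else 0 : ℕ)
          : ℝ) := by
        calc (N : ℝ) ≤ N * ∑ k ∈ F, c k * if y ∈ Metric.closedBall (x k) (r k) then 1 else 0 :=
              le_mul_of_one_le_right (Nat.cast_nonneg _) (h y)
          _ ≤ _ := by
              rw [Finset.mul_sum]
              push_cast
              refine Finset.sum_le_sum fun k _ => ?_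
              split_ifs
              · simpa using Nat.le_ceil _
              · simp
      exact_mod_cast this
    have h2 : ∑ k ∈ F, (⌈N * c k⌉₊ : ℝ) * r k ^ (s : ℝ) ≤
        ∑ k ∈ F, (N * (c k * r k ^ (s : ℝ)) + r k ^ (s : ℝ)) := by
      refine Finset.sum_le_sum fun k _ => ?_
      have h3 := (Nat.ceil_lt_add_one (mul_nonneg (Nat.cast_nonneg N) (hc0 k))).le
      have h4 := Real.rpow_nonneg (hr0 k).le s
      nlinarith
    rw [Finset.sum_add_distrib, ← Finset.mul_sum] at h2
    linarith
  by_contra! hlt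
  obtain ⟨N, hN⟩ := exists_nat_gt ((∑ k ∈ F, r k ^ (s : ℝ)) / (1 - ∑ k ∈ F, c k * r k ^ (s : ℝ)))
  rw [div_lt_iff₀ (by linarith)] at hN
  linarith [hb N]

/-- Weighted covers of a product of spaces: sections reduce to weighted covers of the factors. -/
theorem one_le_sum_mul_pow {Y ι : Type*} (F : Finset ι) (w : ι → ℝ) (hw : ∀ k, 0 ≤ w k) (n : ℕ)
    (φ : Fin n → ι → Y → ℝ) (hφ : ∀ i k y, 0 ≤ φ i k y)
    (H : ∀ i, ∀ c : ι → ℝ, (∀ k, 0 ≤ c k) → (∀ y, 1 ≤ ∑ k ∈ F, c k * φ i k y) →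
      1 ≤ ∑ k ∈ F, c k * w k)
    (c : ι → ℝ) (hc : ∀ k, 0 ≤ c k)
    (h : ∀ y : Fin n → Y, 1 ≤ ∑ k ∈ F, c k * ∏ i, φ i k (y i)) :
    1 ≤ ∑ k ∈ F, c k * w k ^ n := by
  induction n generalizing c with
  | zero => simpa using h finZeroElim
  | succ n ih =>
    have h1 : ∀ y₀, 1 ≤ ∑ k ∈ F, (c k * w k ^ n) * φ 0 k y₀ := by
      intro y₀
      -- Freezing `y₀` absorbs its factor into the weights.
      have := ih (fun i => φ i.succ) (fun i => hφ i.succ) (fun i => H i.succ)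
        (fun k => c k * φ 0 k y₀) (fun k => mul_nonneg (hc k) (hφ 0 k y₀)) fun y => by
          simpa [Fin.prod_univ_succ, mul_assoc] using h (Fin.cons y₀ y)
      exact this.trans_eq (Finset.sum_congr rfl fun k _ => by ring)
    exact (H 0 _ (fun k => mul_nonneg (hc k) (pow_nonneg (hw k) n)) h1).trans_eq
      (Finset.sum_congr rfl fun k _ => by ring)

open Classical in
theorem one_le_sum_of_box_cover {ι : Type*} {s : ℝ≥0} {ε : ℝ} (hε : 0 < ε)
    (hc : ENNReal.ofReal (10 ^ (s : ℝ)) ≤ hausdorffContent (dist : M → M → ℝ) s ε)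
    (F : Finset ι) (n : ℕ) (x : ι → Fin n → M) (r : ι → ℝ) (hr0 : ∀ k, 0 < r k)
    (hr : ∀ k, 10 * r k < ε)
    (h : ∀ y : Fin n → M, ∃ k ∈ F, ∀ i, y i ∈ Metric.closedBall (x k i) (r k)) :
    1 ≤ ∑ k ∈ F, r k ^ ((n : ℝ) * s) := by
  have := one_le_sum_mul_pow F (fun k => r k ^ (s : ℝ)) (fun k => Real.rpow_nonneg (hr0 k).le _) n
    (fun i k y => if y ∈ Metric.closedBall (x k i) (r k) then 1 else 0)
    (fun i k y => by positivity)
    (fun i c hc0 hy => one_le_sum_of_weighted_ball_cover hε hc F (fun k => x k i) r hr0 hr c hc0 hy)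
    (fun _ => 1) (fun _ => zero_le_one) (fun y => by
      obtain ⟨k, hk, hy⟩ := h y
      refine le_trans ?_ (Finset.single_le_sum (fun k _ => ?_) hk)
      · simp [hy]
      · exact mul_nonneg zero_le_one (Finset.prod_nonneg fun i _ => by positivity))
  refine this.trans_eq (Finset.sum_congr rfl fun k _ => ?_)
  rw [one_mul, ← Real.rpow_natCast, ← Real.rpow_mul (hr0 k).le, mul_comm]

theorem one_le_hausdorffContent_of_proj [CompactSpace M] [Nonempty M] {X : Type*}
    {ρ : X → X → ℝ} {n : ℕ} (hn : n ≠ 0) {s : ℝ≥0} (hs : 0 < s) {ε : ℝ} (hε : 0 < ε)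
    (hc : ENNReal.ofReal (10 ^ (s : ℝ)) ≤ hausdorffContent (dist : M → M → ℝ) s ε)
    (p : X → Fin n → M) (hp : Function.Surjective p)
    (hd : ∀ x y i, dist (p x i) (p y i) ≤ ρ x y) :
    1 ≤ hausdorffContent ρ (n * s) (ε / 10) := by
  refine le_iInf fun E => le_iInf fun hE => le_iInf fun hlt => ?_
  have hns : 0 < (n : ℝ≥0) * s := by positivity
  simp_rw [diamPow_of_pos hns]
  refine ENNReal.le_of_forall_pos_le_add fun η hη _ => ?_
  -- Radii must be positive and exceed the diameters, which may be 0; the excess at index `k` is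
  -- paid from `δ k`.
  obtain ⟨δ, hδ0, hδ⟩ := ENNReal.exists_pos_sum_of_countable
    (ENNReal.coe_pos.2 hη).ne' ℕ
  have hr : ∀ k, ∃ r : ℝ, 0 < r ∧ 10 * r < ε ∧ setDiam ρ (E k) < ENNReal.ofReal r ∧
      ENNReal.ofReal r ^ ((n * s : ℝ≥0) : ℝ) ≤ setDiam ρ (E k) ^ ((n * s : ℝ≥0) : ℝ) + δ k := by
    intro k
    have hfin : setDiam ρ (E k) ≠ ⊤ := (hlt k).ne_top
    have hcont : Tendsto (fun t : ℝ≥0∞ => t ^ ((n * s : ℝ≥0) : ℝ)) (𝓝[>] (setDiam ρ (E k)))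
        (𝓝 (setDiam ρ (E k) ^ ((n * s : ℝ≥0) : ℝ))) :=
      (ENNReal.continuous_rpow_const.tendsto _).mono_left nhdsWithin_le_nhds
    have hpow : setDiam ρ (E k) ^ ((n * s : ℝ≥0) : ℝ) ≠ ⊤ :=
      ENNReal.rpow_ne_top_of_nonneg (NNReal.coe_nonneg _) hfin
    have h1 := hcont.eventually_lt_const (ENNReal.lt_add_right hpow
      (ENNReal.coe_pos.2 (hδ0 k)).ne')
    have h2 := Ioo_mem_nhdsGT (hlt k)
    have : (𝓝[>] (setDiam ρ (E k))).NeBot := nhdsGT_neBot_of_exists_gt ⟨_, hlt k⟩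
    obtain ⟨t, ht1, ht2⟩ := (h1.and h2).exists
    have htop : t ≠ ⊤ := ht2.2.ne_top
    refine ⟨t.toReal, ENNReal.toReal_pos (ne_bot_of_gt ht2.1) htop, ?_, ?_, ?_⟩
    · have := (ENNReal.lt_ofReal_iff_toReal_lt htop).1 ht2.2
      linarith
    · rw [ENNReal.ofReal_toReal htop]; exact ht2.1
    · rw [ENNReal.ofReal_toReal htop]; exact ht1.le
  choose r hr0 hrε hrd hrp using hr
  have hx : ∀ k, ∃ x : Fin n → M, ∀ z ∈ E k, ∀ i, dist (p z i) (x i) < r k := by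
    intro k
    rcases (E k).eq_empty_or_nonempty with h | ⟨z₀, hz₀⟩
    · exact ⟨fun _ => Classical.arbitrary M, by simp [h]⟩
    · refine ⟨p z₀, fun z hz i => (hd z z₀ i).trans_lt ?_⟩
      exact (ENNReal.ofReal_lt_ofReal_iff (hr0 k)).1 ((le_setDiam hz hz₀).trans_lt (hrd k))
  choose x hx using hx
  -- The strict inequality `r k > diam` allows open boxes, so compactness of `M^n` leaves finitely
  -- many.
  obtain ⟨F, hF⟩ := isCompact_univ.elim_finite_subcover
    (fun k => ⋂ i, (fun y : Fin n → M => y i) ⁻¹' Metric.ball (x k i) (r k))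
    (fun k => isOpen_iInter_of_finite fun i => Metric.isOpen_ball.preimage (continuous_apply i))
    (fun y _ => by
      obtain ⟨z, rfl⟩ := hp y
      obtain ⟨k, hk⟩ := Set.mem_iUnion.1 (hE.ge (Set.mem_univ z))
      exact Set.mem_iUnion.2 ⟨k, Set.mem_iInter.2 fun i => hx k z hk i⟩)
  have key := one_le_sum_of_box_cover hε hc F n x r hr0 hrε fun y => by
    obtain ⟨k, hk, hy⟩ := Set.mem_iUnion₂.1 (hF (Set.mem_univ y))
    exact ⟨k, hk, fun i => Metric.ball_subset_closedBall (Set.mem_iInter.1 hy i)⟩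
  calc (1 : ℝ≥0∞) = ENNReal.ofReal 1 := by simp
    _ ≤ ENNReal.ofReal (∑ k ∈ F, r k ^ ((n : ℝ) * s)) := ENNReal.ofReal_le_ofReal key
    _ = ∑ k ∈ F, ENNReal.ofReal (r k) ^ ((n * s : ℝ≥0) : ℝ) := by
      rw [ENNReal.ofReal_sum_of_nonneg fun k _ => Real.rpow_nonneg (hr0 k).le _]
      refine Finset.sum_congr rfl fun k _ => ?_
      rw [ENNReal.ofReal_rpow_of_pos (hr0 k)]
      push_cast
      rfl
    _ ≤ ∑' k, ENNReal.ofReal (r k) ^ ((n * s : ℝ≥0) : ℝ) := ENNReal.sum_le_tsum F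
    _ ≤ ∑' k, (setDiam ρ (E k) ^ ((n * s : ℝ≥0) : ℝ) + δ k) := ENNReal.tsum_le_tsum hrp
    _ ≤ _ := by
      rw [ENNReal.tsum_add]
      gcongr

theorem dimH_le_lowerMeanDimH [CompactSpace M] [Nonempty M] {X : Type*}
    {ρ : X → X → ℝ} {f : X → X} (p : ∀ n : ℕ, X → Fin n → M)
    (hp : ∀ n, Function.Surjective (p n))
    (hd : ∀ n x y i, dist (p n x i) (p n y i) ≤ dynDist ρ f n x y) :
    dimH (Set.univ : Set M) ≤ lowerMeanDimH ρ f := by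
  refine ENNReal.le_of_forall_nnreal_lt fun s hs => ?_
  rcases eq_zero_or_pos s with rfl | hs0
  · simp
  obtain ⟨ε, hε, hc⟩ := exists_le_hausdorffContent hs
    (ENNReal.ofReal_lt_top (r := 10 ^ (s : ℝ)))
  refine le_iSup₂_of_le (ε / 10) (by positivity) (le_liminf_of_le (by isBoundedDefault) ?_)
  filter_upwards [eventually_ne_atTop 0] with n hn
  rw [ENNReal.le_div_iff_mul_le (by simp [hn]) (by simp)]
  refine le_iSup₂_of_le ((n : ℝ≥0) * s)
    (one_le_hausdorffContent_of_proj hn hs0 hε hc (p n) (hp n) (hd n)) ?_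
  push_cast
  rw [mul_comm]

end Lower

/-! ### Upper bound through box covers -/

section Upper

theorem hausdorffContent_le_card_mul {X ι : Type*} [Fintype ι] {ρ : X → X → ℝ} (s : ℝ≥0)
    {r ε : ℝ} (hε : 0 < ε) (hrε : r < ε) (E : ι → Set X) (hE : ⋃ i, E i = Set.univ)
    (hd : ∀ i, ∀ x ∈ E i, ∀ y ∈ E i, ρ x y ≤ r) :
    hausdorffContent ρ s ε ≤ Fintype.card ι * ENNReal.ofReal r ^ (s : ℝ) := by
  refine (hausdorffContent_le_tsum s hε E hE fun i => (setDiam_le (hd i)).trans_lt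
    ((ENNReal.ofReal_lt_ofReal_iff hε).2 hrε)).trans ?_
  rw [tsum_fintype]
  refine (Finset.sum_le_card_nsmul _ _ (ENNReal.ofReal r ^ (s : ℝ)) fun i _ =>
    (diamPow_le s _).trans (ENNReal.rpow_le_rpow (setDiam_le (hd i)) s.2)).trans_eq ?_
  simp

/-- Content at least 1 forces `1 ≤ card * r ^ s`; taking logarithms bounds `s`. -/
theorem dimHScale_le_of_cover {X ι : Type*} [Fintype ι] {ρ : X → X → ℝ} {r ε : ℝ} (hr0 : 0 < r)
    (hr1 : r < 1) (hrε : r < ε) (E : ι → Set X) (hE : ⋃ i, E i = Set.univ)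
    (hd : ∀ i, ∀ x ∈ E i, ∀ y ∈ E i, ρ x y ≤ r) :
    dimHScale ρ ε ≤ ENNReal.ofReal (Real.log (Fintype.card ι) / -Real.log r) := by
  refine iSup₂_le fun s hs => ?_
  have hlog : 0 < -Real.log r := neg_pos.2 (Real.log_neg hr0 hr1)
  rw [← ENNReal.ofReal_coe_nnreal]
  refine ENNReal.ofReal_le_ofReal ?_
  rw [le_div_iff₀ hlog]
  have h1 := hs.trans (hausdorffContent_le_card_mul s (hr0.trans hrε) hrε E hE hd)
  rw [ENNReal.ofReal_rpow_of_pos hr0, ← ENNReal.ofReal_natCast,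
    ← ENNReal.ofReal_mul (by positivity), ENNReal.one_le_ofReal] at h1
  have hcard : (0 : ℝ) < Fintype.card ι := by
    refine lt_of_le_of_ne (by positivity) fun h => ?_
    rw [← h] at h1
    norm_num at h1
  have h2 := Real.log_nonneg h1
  rw [Real.log_mul hcard.ne' (Real.rpow_pos_of_pos hr0 _).ne', Real.log_rpow hr0] at h2
  linarith

variable {M : Type*} [MetricSpace M]

/-- Compactness makes the set of cardinalities nonempty, so its `sInf` is attained and is not the
default 0. -/
theorem exists_cover_boxNumber [CompactSpace M] {δ : ℝ} (hδ : 0 < δ) :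
    ∃ E : Fin (boxNumber M δ) → Set M,
      ⋃ i, E i = Set.univ ∧ ∀ i, Metric.ediam (E i) ≤ ENNReal.ofReal δ := by
  refine Nat.sInf_mem (s := {m : ℕ | ∃ E : Fin m → Set M,
    ⋃ i, E i = Set.univ ∧ ∀ i, Metric.ediam (E i) ≤ ENNReal.ofReal δ}) ?_
  obtain ⟨t, -, ht, hcov⟩ := finite_cover_balls_of_compact (isCompact_univ (X := M))
    (half_pos hδ)
  lift t to Finset M using ht
  refine ⟨t.card, fun i => Metric.ball (t.equivFin.symm i) (δ / 2), ?_, fun i => ?_⟩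
  · refine Set.eq_univ_of_forall fun y => ?_
    obtain ⟨x, hx, hy⟩ := Set.mem_iUnion₂.1 (hcov (Set.mem_univ y))
    exact Set.mem_iUnion.2 ⟨t.equivFin ⟨x, hx⟩, by simpa using hy⟩
  · refine Metric.ediam_le fun a ha b hb => ?_
    rw [edist_dist]
    refine ENNReal.ofReal_le_ofReal ?_
    linarith [dist_triangle_right a b (t.equivFin.symm i : M), Metric.mem_ball.1 ha,
      Metric.mem_ball.1 hb]

theorem boxNumber_pos [CompactSpace M] [Nonempty M] {δ : ℝ} (hδ : 0 < δ) : 0 < boxNumber M δ := by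
  obtain ⟨E, hE, -⟩ := exists_cover_boxNumber (M := M) hδ
  obtain ⟨i, -⟩ := Set.mem_iUnion.1 (hE.ge (Set.mem_univ (Classical.arbitrary M)))
  exact i.pos

/-- If `ρ` is controlled by `m` coordinates in `M`, then so is its dimension at a given scale. -/
theorem dimHScale_le_boxNumber [CompactSpace M] [Nonempty M] {X T : Type*} [Fintype T]
    {ρ : X → X → ℝ} {δ r ε : ℝ} (hδ : 0 < δ) (hr0 : 0 < r) (hr1 : r < 1) (hrε : r < ε)
    (q : X → T → M) (hq : ∀ x y, (∀ t, dist (q x t) (q y t) ≤ δ) → ρ x y ≤ r) {m : ℕ}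
    (hm : Fintype.card T ≤ m) :
    dimHScale ρ ε ≤ m * ENNReal.ofReal (Real.log (boxNumber M δ) / -Real.log r) := by
  classical
  obtain ⟨E, hE, hd⟩ := exists_cover_boxNumber (M := M) hδ
  have hlog : 0 < -Real.log r := neg_pos.2 (Real.log_neg hr0 hr1)
  have hN : (1 : ℝ) ≤ boxNumber M δ := by exact_mod_cast boxNumber_pos hδ
  refine (dimHScale_le_of_cover hr0 hr1 hrε
    -- One cell for each choice of a covering set per coordinate.
    (fun g : T → Fin (boxNumber M δ) => {x | ∀ t, q x t ∈ E (g t)}) ?_ ?_).trans ?_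
  · refine Set.eq_univ_of_forall fun x => ?_
    have : ∀ t, ∃ i, q x t ∈ E i := fun t => Set.mem_iUnion.1 (hE.ge (Set.mem_univ _))
    choose g hg using this
    exact Set.mem_iUnion.2 ⟨g, hg⟩
  · intro g x hx y hy
    refine hq x y fun t => ?_
    have := (Metric.edist_le_ediam_of_mem (hx t) (hy t)).trans (hd (g t))
    rwa [edist_dist, ENNReal.ofReal_le_ofReal_iff hδ.le] at this
  · rw [← ENNReal.ofReal_natCast m, ← ENNReal.ofReal_mul (by positivity)]
    refine ENNReal.ofReal_le_ofReal ?_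
    rw [Fintype.card_fun, Fintype.card_fin, Nat.cast_pow, Real.log_pow, mul_div_assoc]
    have : (Fintype.card T : ℝ) ≤ m := by exact_mod_cast hm
    have := Real.log_nonneg hN
    gcongr

theorem tendsto_natCast_add_div (L : ℕ) :
    Tendsto (fun n : ℕ => ((n + L : ℕ) : ℝ≥0∞) / n) atTop (𝓝 1) := by
  have h : Tendsto (fun n : ℕ => 1 + (L : ℝ≥0∞) / n) atTop (𝓝 (1 + 0)) :=
    tendsto_const_nhds.add (ENNReal.Tendsto.const_div ENNReal.tendsto_nat_nhds_top
      (Or.inr (ENNReal.natCast_ne_top L)) |>.trans (by simp))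
  rw [add_zero] at h
  refine h.congr' ?_
  filter_upwards [eventually_ne_atTop 0] with n hn
  rw [Nat.cast_add, ENNReal.add_div, ENNReal.div_self (by simpa using hn) (by simp)]

theorem upperMeanDimH_le_lowerBoxDim [CompactSpace M] [Nonempty M] {X : Type*}
    {ρ : X → X → ℝ} {f : X → X} {C : ℝ} (hC : 0 < C)
    (h : ∀ δ : ℝ, 0 < δ → ∃ L : ℕ, ∀ n : ℕ, ∃ (T : Type) (_ : Fintype T) (q : X → T → M),
      Fintype.card T ≤ n + L ∧
      ∀ x y, (∀ t, dist (q x t) (q y t) ≤ δ) → dynDist ρ f n x y ≤ C * δ) :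
    upperMeanDimH ρ f ≤ lowerBoxDim M := by
  refine iSup₂_le fun ε hε => ?_
  have hbound : ∀ δ : ℝ, 0 < δ → C * δ < 1 → C * δ < ε →
      limsup (fun n : ℕ => dimHScale (dynDist ρ f n) ε / n) atTop ≤
        ENNReal.ofReal (Real.log (boxNumber M δ) / -Real.log (C * δ)) := by
    intro δ hδ h1 h2
    obtain ⟨L, hL⟩ := h δ hδ
    set B := ENNReal.ofReal (Real.log (boxNumber M δ) / -Real.log (C * δ))
    have hlim : Tendsto (fun n : ℕ => ((n + L : ℕ) : ℝ≥0∞) / n * B) atTop (𝓝 (1 * B)) :=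
      ENNReal.Tendsto.mul_const (tendsto_natCast_add_div L) (Or.inl one_ne_zero)
    rw [one_mul] at hlim
    rw [← hlim.limsup_eq]
    refine limsup_le_limsup (Eventually.of_forall fun n => ?_)
    obtain ⟨T, _, q, hT, hq⟩ := hL n
    have := dimHScale_le_boxNumber hδ (mul_pos hC hδ) h1 h2 q hq hT
    calc dimHScale (dynDist ρ f n) ε / n ≤ ((n + L : ℕ) : ℝ≥0∞) * B / n := by gcongr
      _ = ((n + L : ℕ) : ℝ≥0∞) / n * B := by rw [ENNReal.mul_div_right_comm]
  -- The ratio is `1 + log C / log δ`, so replacing `C * δ` by `δ` is harmless in the limit.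
  have hratio : Tendsto (fun δ : ℝ => ENNReal.ofReal (-Real.log (C * δ) / -Real.log δ))
      (𝓝[>] 0) (𝓝 1) := by
    have hlog : Tendsto (fun δ : ℝ => 1 + Real.log C / Real.log δ) (𝓝[>] 0) (𝓝 (1 + 0)) :=
      tendsto_const_nhds.add (Real.tendsto_log_nhdsGT_zero.const_div_atBot _)
    rw [← ENNReal.ofReal_one, ← add_zero (1 : ℝ)]
    refine (ENNReal.tendsto_ofReal hlog).congr' ?_
    filter_upwards [Ioo_mem_nhdsGT zero_lt_one] with δ hδ
    have := (Real.log_neg hδ.1 hδ.2).ne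
    rw [Real.log_mul hC.ne' hδ.1.ne']
    congr 1
    field_simp
    ring
  have hlim := ENNReal.Tendsto.const_mul
    (a := limsup (fun n : ℕ => dimHScale (dynDist ρ f n) ε / n) atTop) hratio
    (Or.inl one_ne_zero)
  rw [mul_one] at hlim
  rw [← hlim.liminf_eq]
  refine liminf_le_liminf ?_
  -- Ensures `δ < 1`, `C * δ < 1` and `C * δ < ε`.
  have hpos : 0 < min 1 (min (1 / C) (ε / C)) := by positivity
  filter_upwards [Ioo_mem_nhdsGT hpos] with δ hδ
  obtain ⟨hδ0, hδ⟩ := hδ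
  rw [lt_min_iff, lt_min_iff, lt_div_iff₀' hC, lt_div_iff₀' hC] at hδ
  obtain ⟨hδ1, hδC, hδε⟩ := hδ
  have hC1 : 0 < -Real.log (C * δ) := neg_pos.2 (Real.log_neg (mul_pos hC hδ0) hδC)
  have hlog1 : 0 < -Real.log δ := neg_pos.2 (Real.log_neg hδ0 hδ1)
  have hN : (1 : ℝ) ≤ boxNumber M δ := by exact_mod_cast boxNumber_pos hδ0
  have := Real.log_nonneg hN
  refine (mul_le_mul_left (hbound δ hδ0 hδC hδε) _).trans_eq ?_
  rw [← ENNReal.ofReal_mul (by positivity), div_mul_div_cancel₀ hC1.ne']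

end Upper

/-! ### Weighted distances and the shift -/

section Shift

variable {M : Type*} [MetricSpace M] {X : Type*}

theorem le_dynDist (ρ : X → X → ℝ) (f : X → X) {n : ℕ} (i : Fin n) (x y : X) :
    ρ (f^[i] x) (f^[i] y) ≤ dynDist ρ f n x y :=
  le_ciSup (f := fun i : Fin n => ρ (f^[i] x) (f^[i] y)) (Set.finite_range _).bddAbove i

theorem dynDist_le {ρ : X → X → ℝ} {f : X → X} {n : ℕ} {x y : X} {r : ℝ} (hr : 0 ≤ r)
    (h : ∀ i < n, ρ (f^[i] x) (f^[i] y) ≤ r) : dynDist ρ f n x y ≤ r :=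
  Real.iSup_le (fun i => h i i.2) hr

theorem shift_iterate {K N : Type*} [AddMonoidWithOne K] (x : K → N) (i : ℕ) (k : K) :
    shift^[i] x k = x (k + i) := by
  induction i generalizing x with
  | zero => simp
  | succ i ih => rw [Function.iterate_succ_apply, ih, shift, Nat.cast_succ, add_assoc]

variable {K : Type*} {a : K → ℝ}

/-- The distance `∑ a_j d(x_j, y_j)` on `M^K`. -/
noncomputable def weightedDist (a : K → ℝ) (x y : K → M) : ℝ := ∑' j, a j * dist (x j) (y j)

theorem summable_weightedDist [CompactSpace M] (ha0 : ∀ j, 0 ≤ a j) (ha : Summable a)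
    (x y : K → M) : Summable fun j => a j * dist (x j) (y j) :=
  Summable.of_nonneg_of_le (fun j => mul_nonneg (ha0 j) dist_nonneg)
    (fun j => mul_le_mul_of_nonneg_left
      (Metric.dist_le_diam_of_mem isCompact_univ.isBounded trivial trivial) (ha0 j))
    (ha.mul_right (Metric.diam (Set.univ : Set M)))

theorem dimH_le_lowerMeanDimH_shift [CompactSpace M] [Nonempty M] [AddMonoidWithOne K]
    [CharZero K] (ha0 : ∀ j, 0 ≤ a j) (ha : Summable a) (h0 : a 0 = 1) :
    dimH (Set.univ : Set M) ≤ lowerMeanDimH (weightedDist (M := M) a) shift := by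
  refine dimH_le_lowerMeanDimH (fun n x i => x ((i : ℕ) : K)) (fun n y => ?_) fun n x y i => ?_
  · have hinj : Function.Injective fun i : Fin n => ((i : ℕ) : K) :=
      Nat.cast_injective.comp Fin.val_injective
    exact ⟨Function.extend _ y fun _ => Classical.arbitrary M,
      funext fun i => hinj.extend_apply y _ i⟩
  · refine le_trans ?_ (le_dynDist _ _ i x y)
    -- The term `j = 0` of the distance after `i` shifts is the distance of the `i`-th coordinates.
    have := (summable_weightedDist ha0 ha (shift^[i] x) (shift^[i] y)).le_tsum 0
      fun j _ => mul_nonneg (ha0 j) dist_nonneg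
    simpa [h0, shift_iterate, weightedDist] using this

/-- Outside a large finite `S`, the weights times the diameter of `M` sum to less than `δ`; this is
the `+ 1`. -/
theorem exists_weightedDist_le [CompactSpace M] (ha0 : ∀ j, 0 ≤ a j) (ha : Summable a) {δ : ℝ}
    (hδ : 0 < δ) : ∃ S : Finset K, ∀ x y : K → M, (∀ j ∈ S, dist (x j) (y j) ≤ δ) →
      weightedDist a x y ≤ (∑' j, a j + 1) * δ := by
  set D := Metric.diam (Set.univ : Set M)
  have hlim := (tendsto_tsum_compl_atTop_zero a).mul_const D
  rw [zero_mul] at hlim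
  obtain ⟨S, hS⟩ := (hlim.eventually_lt_const hδ).exists
  refine ⟨S, fun x y h => ?_⟩
  have hsum := summable_weightedDist ha0 ha x y
  rw [weightedDist, ← hsum.sum_add_tsum_subtype_compl S, add_mul, one_mul]
  refine add_le_add ?_ (le_trans ?_ hS.le)
  · calc ∑ j ∈ S, a j * dist (x j) (y j) ≤ ∑ j ∈ S, a j * δ :=
        Finset.sum_le_sum fun j hj => mul_le_mul_of_nonneg_left (h j hj) (ha0 j)
      _ = (∑ j ∈ S, a j) * δ := by rw [Finset.sum_mul]
      _ ≤ _ := mul_le_mul_of_nonneg_right (ha.sum_le_tsum S fun j _ => ha0 j) hδ.le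
  · rw [← tsum_mul_right]
    exact (hsum.subtype _).tsum_le_tsum (fun j => mul_le_mul_of_nonneg_left
      (Metric.dist_le_diam_of_mem isCompact_univ.isBounded trivial trivial) (ha0 j))
      ((ha.subtype _).mul_right D)

/-- `hK` says that the translates of a finite window by `0, ..., n-1` fill only `n + O(1)` indices.
-/
theorem upperMeanDimH_shift_le_lowerBoxDim [CompactSpace M] [Nonempty M] {K : Type}
    [AddMonoidWithOne K] {a : K → ℝ} (ha0 : ∀ j, 0 ≤ a j) (ha : Summable a)
    (hK : ∀ S : Finset K, ∃ L : ℕ, ∀ n : ℕ, ∃ T : Finset K, T.card ≤ n + L ∧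
      ∀ j ∈ S, ∀ i < n, j + (i : ℕ) ∈ T) :
    upperMeanDimH (weightedDist (M := M) a) shift ≤ lowerBoxDim M := by
  have hC : 0 < ∑' j, a j + 1 := add_pos_of_nonneg_of_pos (tsum_nonneg ha0) one_pos
  refine upperMeanDimH_le_lowerBoxDim hC fun δ hδ => ?_
  obtain ⟨S, hS⟩ := exists_weightedDist_le (M := M) ha0 ha hδ
  obtain ⟨L, hL⟩ := hK S
  refine ⟨L, fun n => ?_⟩
  obtain ⟨T, hT, hST⟩ := hL n
  refine ⟨T, inferInstance, fun x t => x t, by simpa using hT, fun x y hxy => ?_⟩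
  refine dynDist_le (by positivity) fun i hi => hS _ _ fun j hj => ?_
  rw [shift_iterate, shift_iterate]
  exact hxy ⟨_, hST j hj i hi⟩

theorem lowerMeanDimH_le_upperMeanDimH (ρ : X → X → ℝ) (f : X → X) :
    lowerMeanDimH ρ f ≤ upperMeanDimH ρ f :=
  iSup₂_mono fun _ _ => liminf_le_limsup

theorem exists_card_le_of_nat (S : Finset ℕ) : ∃ L : ℕ, ∀ n : ℕ, ∃ T : Finset ℕ,
    T.card ≤ n + L ∧ ∀ j ∈ S, ∀ i < n, j + ((i : ℕ) : ℕ) ∈ T := by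
  refine ⟨S.sup id, fun n => ⟨Finset.range (n + S.sup id), by simp, fun j hj i hi => ?_⟩⟩
  have : j ≤ S.sup id := Finset.le_sup (f := id) hj
  simp only [Finset.mem_range]
  omega

theorem exists_card_le_of_int (S : Finset ℤ) : ∃ L : ℕ, ∀ n : ℕ, ∃ T : Finset ℤ,
    T.card ≤ n + L ∧ ∀ j ∈ S, ∀ i < n, j + ((i : ℕ) : ℤ) ∈ T := by
  set l := S.sup Int.natAbs
  refine ⟨2 * l, fun n => ⟨Finset.Ico (-l : ℤ) (n + l), ?_, fun j hj i hi => ?_⟩⟩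
  · simp only [Int.card_Ico]
    omega
  · have : j.natAbs ≤ l := Finset.le_sup (f := Int.natAbs) hj
    simp only [Finset.mem_Ico]
    omega

theorem summable_one_div_two_pow_natAbs : Summable fun j : ℤ => (1 : ℝ) / 2 ^ j.natAbs := by
  have h : Summable fun j : ℕ => (1 : ℝ) / 2 ^ j := by
    simpa only [one_div_pow] using summable_geometric_two
  exact Summable.of_nat_of_neg (by simpa using h) (by simpa using h)

end Shift

end MeanHausdorff

theorem mainTheorem3 (M : Type*) [MetricSpace M] [CompactSpace M] [Nonempty M] :
    (dimH (Set.univ : Set M)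
          ≤ MeanHausdorff.lowerMeanDimH (MeanHausdorff.seqDist (M := M)) MeanHausdorff.shift ∧
      MeanHausdorff.lowerMeanDimH (MeanHausdorff.seqDist (M := M)) MeanHausdorff.shift
          ≤ MeanHausdorff.upperMeanDimH (MeanHausdorff.seqDist (M := M)) MeanHausdorff.shift ∧
      MeanHausdorff.upperMeanDimH (MeanHausdorff.seqDist (M := M)) MeanHausdorff.shift
          ≤ MeanHausdorff.lowerBoxDim M) ∧
    (dimH (Set.univ : Set M)
          ≤ MeanHausdorff.lowerMeanDimH (MeanHausdorff.biseqDist (M := M)) MeanHausdorff.shift ∧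
      MeanHausdorff.lowerMeanDimH (MeanHausdorff.biseqDist (M := M)) MeanHausdorff.shift
          ≤ MeanHausdorff.upperMeanDimH (MeanHausdorff.biseqDist (M := M)) MeanHausdorff.shift ∧
      MeanHausdorff.upperMeanDimH (MeanHausdorff.biseqDist (M := M)) MeanHausdorff.shift
          ≤ MeanHausdorff.lowerBoxDim M) := by
  have hN : Summable fun j : ℕ => (1 : ℝ) / 2 ^ j := by
    simpa only [one_div_pow] using summable_geometric_two
  have hZ := MeanHausdorff.summable_one_div_two_pow_natAbs
  exact ⟨⟨MeanHausdorff.dimH_le_lowerMeanDimH_shift (fun j => by positivity) hN (by simp),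
      MeanHausdorff.lowerMeanDimH_le_upperMeanDimH _ _,
      MeanHausdorff.upperMeanDimH_shift_le_lowerBoxDim (fun j => by positivity) hN
        MeanHausdorff.exists_card_le_of_nat⟩,
    ⟨MeanHausdorff.dimH_le_lowerMeanDimH_shift (fun j => by positivity) hZ (by simp),
      MeanHausdorff.lowerMeanDimH_le_upperMeanDimH _ _,
      MeanHausdorff.upperMeanDimH_shift_le_lowerBoxDim (fun j => by positivity) hZ
        MeanHausdorff.exists_card_le_of_int⟩⟩
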